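/- **Conventions.** All vector spaces are over $\mathbb F_2$. A *CSS code* $\mathrm Q$ is given by a bounded chain complex of finite-dimensional based vector spaces $\cdots\to \mathrm Q_1\xrightarrow{\partial_1}\mathrm Q_0\xrightarrow{\partial_0}\mathrm Q_{-1}\to\cdots$ with parity-check matrices $H_X=\partial_0$ and $H_Z=\partial_1^{\mathsf T}$ (so the qubits are the basis elements of $\mathrm Q_0$; for a 3-term complex this is just a pair of matrices with $H_XH_Z^{\mathsf T}=0$). Write $Z_i,B_i$ for cycles and boundaries and $Z^i,B^i$ for cocycles and coboundaries (with $\delta_i=\partial_{i+1}^{\mathsf T}$), and $|\cdot|$ for Hamming weight. The distances are $$d_X=\min_{x\in\ker H_Z\setminus \mathrm{rs}\,H_X}|x|,\qquad d_Z=\min_{z\in\ker H_X\setminus \mathrm{rs}\,H_Z}|z|,$$ where a minimum over the empty set is $\infty$ and $\mathrm{rs}$ is the row space. **Middle-sector homological product code.** Let $\mathrm Q,\mathrm Q'$ be CSS codes with distances $(d_X,d_Z)$ and $(d_X',d_Z')$. Let $\tilde{\mathrm Q}=\mathrm Q\otimes \mathrm Q'$ be the tensor product complex, with $\tilde{\mathrm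 Q}_0=\bigoplus_i \mathrm Q_i\otimes \mathrm Q'_{-i}$ and $\partial=\partial\otimes 1+1\otimes\partial'$, and let $\tilde H_X,\tilde H_Z$ be its parity-check matrices. Only the logical qubits of $\mathcal H^0(\mathrm Q)\otimes\mathcal H^0(\mathrm Q')$ are kept; the spurious (co)homologies are gauge. That is, the $X$- and $Z$-type gauge spaces are $$\mathcal G_X=\mathrm{rs}\,\tilde H_X+\sum_{i\ne0}Z^i(\mathrm Q)\otimes Z^{-i}(\mathrm Q'),\qquad \mathcal G_Z=\mathrm{rs}\,\tilde H_Z+\sum_{i\neq0}Z_i(\mathrm Q)\otimes Z_{-i}(\mathrm Q').$$ A *nontrivial dressed $\overline X$ logical* is an element of $\ker\tilde H_Z\setminus\mathcal G_X$, and a *nontrivial dressed $\overline Z$ logical* is an element of $\ker\tilde H_X\setminus\mathcal G_Z$. Let $d^0(\tilde{\mathrm Q})$ and $d_0(\tilde{\mathrm Q})$ be the minimum Hamming weights of these two kinds of operators (the $0$-cosystolic and $0$-systolic distances with the spurious classes disregarded). For a vector $w\in\tilde{\mathrm Q}_0$ let $w_{\mathrm M}$ be its restriction to the middle sector $\mathrm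 Q_0\otimes \mathrm Q'_0$. **Proposition.** One has $$\max(d_X,d'_X)\le d^0(\tilde{\mathrm Q})\le d_X\cdot d'_X,\qquad \max(d_Z,d'_Z)\le d_0(\tilde{\mathrm Q})\le d_Z\cdot d'_Z .$$ Moreover every nontrivial dressed $\overline X$ logical $\mathbf x$ and every nontrivial dressed $\overline Z$ logical $\mathbf z$ satisfy $$|\mathbf x_{\mathrm M}|\ge\max(d_X,d_X'),\qquad |\mathbf z_{\mathrm M}|\ge\max(d_Z,d_Z').$$ -/

import Mathlib

open scoped Kronecker Matrix

universe u v

/-- A bounded chain complex of finite-dimensional based vector spaces over `𝔽₂`, presented by its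
finite set of cells (the chosen basis elements of all degrees together), the degree of each cell,
and the total boundary matrix: `bd x y` is the coefficient of the cell `x` in the boundary of the
cell `y`. The space of `i`-chains is `C.cells i → ZMod 2`. -/
structure BasedComplex where
  Cell : Type u
  [fintypeCell : Fintype Cell]
  [decEqCell : DecidableEq Cell]
  deg : Cell → ℤ
  bd : Matrix Cell Cell (ZMod 2)
  /-- The boundary lowers the degree by exactly one. -/
  bd_deg : ∀ x y, bd x y ≠ 0 → deg x + 1 = deg y
  /-- The boundary of a boundary vanishes. -/
  bd_bd : bd * bd = 0

namespace BasedComplex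

attribute [instance] BasedComplex.fintypeCell BasedComplex.decEqCell

/-- The `i`-cells. -/
abbrev cells (C : BasedComplex.{u}) (i : ℤ) : Type u := {c : C.Cell // C.deg c = i}

/-- The block of the boundary matrix from degree `j` to degree `i`. For `i + 1 = j` it is the
matrix of the boundary map `∂_j : C_j → C_{j-1}`; all other blocks vanish. -/
def block (C : BasedComplex.{u}) (i j : ℤ) : Matrix (C.cells i) (C.cells j) (ZMod 2) :=
  C.bd.submatrix Subtype.val Subtype.val

theorem block_mul_block (C : BasedComplex.{u}) (i j k : ℤ) (hj : j + 1 = k) :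
    C.block i j * C.block j k = 0 := by
  ext a c
  have h := congrFun (congrFun C.bd_bd a.1) c.1
  simp only [Matrix.mul_apply, Matrix.zero_apply] at h
  simp only [Matrix.mul_apply, Matrix.zero_apply, block, Matrix.submatrix_apply]
  rw [← h]
  refine Finset.sum_of_injOn Subtype.val Subtype.val_injective.injOn
    (fun _ _ => Finset.mem_coe.2 (Finset.mem_univ _)) ?_ (fun _ _ => rfl)
  intro y _ hy
  by_cases h0 : C.bd y c.1 = 0
  · simp [h0]
  · exfalso
    have h1 := C.bd_deg _ _ h0
    have h2 := c.2
    exact hy ⟨⟨y, by omega⟩, by simp, rfl⟩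

/-- `Z_i = ker ∂_i`. -/
def cycles (C : BasedComplex.{u}) (i : ℤ) : Submodule (ZMod 2) (C.cells i → ZMod 2) :=
  LinearMap.ker (C.block (i - 1) i).mulVecLin

/-- `Z^i = ker δ_i`, where `δ_i = ∂_{i+1}ᵀ`. -/
def cocycles (C : BasedComplex.{u}) (i : ℤ) : Submodule (ZMod 2) (C.cells i → ZMod 2) :=
  LinearMap.ker (C.block i (i + 1))ᵀ.mulVecLin

/-! ### The CSS code of a complex

The qubits are the `0`-cells, the `X`-checks the `(-1)`-cells and the `Z`-checks the `1`-cells.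
A complex whose cells all have degree `-1`, `0` or `1` is the same thing as a pair of parity-check
matrices `H_X`, `H_Z` with `H_X H_Zᵀ = 0`. -/

/-- `H_X = ∂_0`. -/
def hX (C : BasedComplex.{u}) : Matrix (C.cells (-1)) (C.cells 0) (ZMod 2) := C.block (-1) 0

/-- `H_Z = ∂_1ᵀ`. -/
def hZ (C : BasedComplex.{u}) : Matrix (C.cells 1) (C.cells 0) (ZMod 2) := (C.block 0 1)ᵀ

theorem hX_mul_hZ_transpose (C : BasedComplex.{u}) : C.hX * C.hZᵀ = 0 :=
  C.block_mul_block (-1) 0 1 rfl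

/-- Supports of `X`-operators commuting with all `Z`-checks: `ker H_Z`. -/
def kerHZ (C : BasedComplex.{u}) : Submodule (ZMod 2) (C.cells 0 → ZMod 2) :=
  LinearMap.ker C.hZ.mulVecLin

/-- Supports of `Z`-operators commuting with all `X`-checks: `ker H_X`. -/
def kerHX (C : BasedComplex.{u}) : Submodule (ZMod 2) (C.cells 0 → ZMod 2) :=
  LinearMap.ker C.hX.mulVecLin

/-- Supports of `X`-stabilizers: the row space of `H_X`. -/
def rsHX (C : BasedComplex.{u}) : Submodule (ZMod 2) (C.cells 0 → ZMod 2) :=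
  LinearMap.range C.hXᵀ.mulVecLin

/-- Supports of `Z`-stabilizers: the row space of `H_Z`. -/
def rsHZ (C : BasedComplex.{u}) : Submodule (ZMod 2) (C.cells 0 → ZMod 2) :=
  LinearMap.range C.hZᵀ.mulVecLin

/-- The least Hamming weight of a vector in `S` (`⊤` if `S` is empty). -/
noncomputable def minWeight {ι : Type u} [Fintype ι] (S : Set (ι → ZMod 2)) : ℕ∞ :=
  ⨅ x ∈ S, (hammingNorm x : ℕ∞)

/-- The `X`-distance of the CSS code, i.e. the `0`-cosystolic distance of the complex. -/
noncomputable def dX (C : BasedComplex.{u}) : ℕ∞ :=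
  minWeight {x | x ∈ C.kerHZ ∧ x ∉ C.rsHX}

/-- The `Z`-distance of the CSS code, i.e. the `0`-systolic distance of the complex. -/
noncomputable def dZ (C : BasedComplex.{u}) : ℕ∞ :=
  minWeight {z | z ∈ C.kerHX ∧ z ∉ C.rsHZ}

/-! ### The homological product -/

/-- The homological (tensor) product: its cells are pairs of cells, degrees add, and the boundary is
`∂ ⊗ 1 + 1 ⊗ ∂'`. -/
def prod (A : BasedComplex.{u}) (B : BasedComplex.{v}) : BasedComplex.{max u v} where
  Cell := A.Cell × B.Cell
  deg c := A.deg c.1 + B.deg c.2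
  bd := A.bd ⊗ₖ (1 : Matrix B.Cell B.Cell (ZMod 2)) + (1 : Matrix A.Cell A.Cell (ZMod 2)) ⊗ₖ B.bd
  bd_deg := by
    rintro ⟨a, b⟩ ⟨a', b'⟩ h
    simp only [Matrix.add_apply, Matrix.kronecker_apply, Matrix.one_apply] at h
    by_cases hA : A.bd a a' = 0
    · by_cases hB : B.bd b b' = 0
      · simp [hA, hB] at h
      · have := B.bd_deg _ _ hB
        by_cases e : a = a'
        · subst e; simp only; omega
        · simp [hA, e] at h
    · have := A.bd_deg _ _ hA
      by_cases e : b = b'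
      · subst e; simp only; omega
      · by_cases e' : a = a'
        · subst e'; omega
        · simp [e, e'] at h
  bd_bd := by
    rw [mul_add, add_mul, add_mul]
    simp only [← Matrix.mul_kronecker_mul, A.bd_bd, B.bd_bd, mul_one, one_mul,
      Matrix.zero_kronecker, Matrix.kronecker_zero, zero_add, add_zero]
    ext i j
    exact CharTwo.add_self_eq_zero _

variable (A : BasedComplex.{u}) (B : BasedComplex.{v})

/-- For chains `f ∈ A_i` and `g ∈ B_j`, the chain `f ⊗ g` of the product, as a vector on the
product `0`-cells: it is supported on the sector of pairs of an `i`-cell and a `j`-cell (which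
consists of `0`-cells if `i + j = 0`). -/
def tensor {i j : ℤ} (f : A.cells i → ZMod 2) (g : B.cells j → ZMod 2) :
    (A.prod B).cells 0 → ZMod 2 := fun c =>
  if h : A.deg c.1.1 = i ∧ B.deg c.1.2 = j then f ⟨c.1.1, h.1⟩ * g ⟨c.1.2, h.2⟩ else 0

/-! ### The middle-sector subsystem code -/

/-- Supports of the `X`-type gauge group: generated by the `X`-stabilizers and the spurious
cohomologies `H^i(A) ⊗ H^{-i}(B)` with `i ≠ 0`. -/
def xGauge : Submodule (ZMod 2) ((A.prod B).cells 0 → ZMod 2) :=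
  (A.prod B).rsHX ⊔ Submodule.span (ZMod 2)
    {w | ∃ i : ℤ, i ≠ 0 ∧ ∃ f ∈ A.cocycles i, ∃ g ∈ B.cocycles (-i), w = tensor A B f g}

/-- Supports of the `Z`-type gauge group: generated by the `Z`-stabilizers and the spurious
homologies `H_i(A) ⊗ H_{-i}(B)` with `i ≠ 0`. -/
def zGauge : Submodule (ZMod 2) ((A.prod B).cells 0 → ZMod 2) :=
  (A.prod B).rsHZ ⊔ Submodule.span (ZMod 2)
    {w | ∃ i : ℤ, i ≠ 0 ∧ ∃ f ∈ A.cycles i, ∃ g ∈ B.cycles (-i), w = tensor A B f g}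

/-- Nontrivial dressed logical `X`-operators of the middle-sector code: `X`-operators that commute
with all `Z`-stabilizers and are not in the gauge group. -/
def dressedX : Set ((A.prod B).cells 0 → ZMod 2) :=
  {x | x ∈ (A.prod B).kerHZ ∧ x ∉ xGauge A B}

/-- Nontrivial dressed logical `Z`-operators of the middle-sector code: `Z`-operators that commute
with all `X`-stabilizers and are not in the gauge group. -/
def dressedZ : Set ((A.prod B).cells 0 → ZMod 2) :=
  {z | z ∈ (A.prod B).kerHX ∧ z ∉ zGauge A B}

/-- The `0`-cosystolic distance of the middle-sector code, spurious cohomologies disregarded. -/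
noncomputable def midCosystolicDist : ℕ∞ := minWeight (dressedX A B)

/-- The `0`-systolic distance of the middle-sector code, spurious homologies disregarded. -/
noncomputable def midSystolicDist : ℕ∞ := minWeight (dressedZ A B)

/-- The weight of a vector on the middle sector, the pairs (`0`-cell of `A`, `0`-cell of `B`). -/
def midWeight (x : (A.prod B).cells 0 → ZMod 2) : ℕ :=
  (Finset.univ.filter fun c : (A.prod B).cells 0 =>
    A.deg c.1.1 = 0 ∧ B.deg c.1.2 = 0 ∧ x c ≠ 0).card

end BasedComplex

/-! The two inequalities for `X` and the two for `Z` are one statement about a square-zero matrix `D`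
over `𝔽₂` that shifts a grading: `D` is the total boundary matrix for the `Z`-distances and its
transpose for the `X`-distances.

Over a field such a differential splits: there are a degree-preserving matrix `P` and a homotopy
`H` with `P + DH + HD = 1` and `PD = DP = 0` (`exists_splitting`), so that a cycle `v` is a boundary
if and only if `P v = 0`. For the product differential `D ⊗ 1 + 1 ⊗ D'` the matrix `P ⊗ P'` is
homotopic to the identity, hence a cycle `x` of degree `0` is, up to a boundary, a combination of
tensors of columns of `P` and `P'`, which are cycles. Consequently `x` lies in the gauge space as
soon as `(P ⊗ P') x` vanishes on the middle sector (`mem_gauge_of_middle_eq_zero`), and conversely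
`(P ⊗ P') x` vanishes there for every `x` in the gauge space (`middle_eq_zero_of_mem_gauge`).

For the lower bounds, take a nonzero entry `(a, b)` of `(P ⊗ P') x` in the middle sector. The slice
of `(1 ⊗ P') x` at `b`, i.e. the contraction of `x` with the row `b` of `P'`, is a cycle of the first
factor which `P` does not kill; it is supported on the projection of the middle-sector support of
`x`, so the middle-sector weight of `x` is at least the distance of the first code. Slicing at `a`
gives the second code. For the upper bounds, if `u`, `u'` are nontrivial then `P u` and `P' u'` are
nonzero, hence so is `(P ⊗ P') (u ⊗ u')` on the middle sector. -/

namespace BasedComplex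

/-! ### Split graded differentials -/

section Differential

set_option linter.unusedSectionVars false

variable {α : Type u} {β : Type v} [Fintype α] [Fintype β] [DecidableEq α] [DecidableEq β]

/-- `D` is a differential over `𝔽₂` on the space with basis `α`, homogeneous of degree `ε` for the
grading `deg`. Boundary matrices have `ε = -1` and their transposes `ε = 1`. -/
structure IsDifferential (D : Matrix α α (ZMod 2)) (deg : α → ℤ) (ε : ℤ) : Prop where
  mul_self : D * D = 0
  deg_eq : ∀ a b, D a b ≠ 0 → deg a = deg b + ε

/-- A splitting of the differential `D`: a degree-preserving matrix `P` that is homotopic to the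
identity through `H` and is annihilated by `D` on both sides. Thus `P` maps every vector to a cycle,
and each cycle to a homologous one; it need not be idempotent. -/
structure Splitting (D : Matrix α α (ZMod 2)) (deg : α → ℤ) where
  P : Matrix α α (ZMod 2)
  H : Matrix α α (ZMod 2)
  deg_eq : ∀ a b, P a b ≠ 0 → deg a = deg b
  P_mul : P * D = 0
  mul_P : D * P = 0
  homotopy : P + (D * H + H * D) = 1

theorem exists_generalized_inverse {K : Type*} [Field K] (D : Matrix α α K) :
    ∃ H : Matrix α α K, D * H * D = D := by
  set f := Matrix.toLin' D with hf
  obtain ⟨g, hg⟩ := f.rangeRestrict.exists_rightInverse_of_surjective f.range_rangeRestrict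
  obtain ⟨h, hh⟩ := LinearMap.exists_extend g
  refine ⟨LinearMap.toMatrix' h, Matrix.toLin'.injective (LinearMap.ext fun x => ?_)⟩
  have h1 : h (f x) = g (f.rangeRestrict x) := LinearMap.congr_fun hh (f.rangeRestrict x)
  have h2 : f (g (f.rangeRestrict x)) = f x :=
    congrArg Subtype.val (LinearMap.congr_fun hg (f.rangeRestrict x))
  rw [Matrix.toLin'_mul, Matrix.toLin'_mul, Matrix.toLin'_toMatrix']
  simp only [LinearMap.comp_apply, ← hf, h1, h2]

theorem exists_splitting {D : Matrix α α (ZMod 2)} {deg : α → ℤ} {ε : ℤ}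
    (hD : IsDifferential D deg ε) : Nonempty (Splitting D deg) := by
  obtain ⟨G, hG⟩ := exists_generalized_inverse D
  -- Only the part of `G` of degree `-ε` contributes to `D * G * D`.
  set H : Matrix α α (ZMod 2) := Matrix.of fun a b => if deg b = deg a + ε then G a b else 0 with hH
  have hH0 : ∀ a b, H a b ≠ 0 → deg b = deg a + ε := by
    intro a b h
    by_contra h'
    simp [hH, h'] at h
  have hDH : D * H * D = D := by
    ext a d
    by_cases had : deg a = deg d + ε
    · conv_rhs => rw [← hG]
      simp only [Matrix.mul_apply, Finset.sum_mul]
      refine Finset.sum_congr rfl fun c _ => Finset.sum_congr rfl fun b _ => ?_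
      by_cases h1 : D a b = 0
      · simp [h1]
      by_cases h2 : D c d = 0
      · simp [h2]
      have h3 := hD.deg_eq _ _ h1
      have h4 := hD.deg_eq _ _ h2
      have h5 : deg c = deg b + ε := by omega
      simp [hH, h5]
    · have h0 : D a d = 0 := by
        by_contra h
        exact had (hD.deg_eq _ _ h)
      rw [h0]
      simp only [Matrix.mul_apply, Finset.sum_mul]
      refine Finset.sum_eq_zero fun c _ => Finset.sum_eq_zero fun b _ => ?_
      by_contra h
      have h1 := hD.deg_eq _ _ (left_ne_zero_of_mul (left_ne_zero_of_mul h))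
      have h2 := hH0 _ _ (right_ne_zero_of_mul (left_ne_zero_of_mul h))
      have h3 := hD.deg_eq _ _ (right_ne_zero_of_mul h)
      omega
  refine ⟨⟨1 - (D * H + H * D), H, ?_, ?_, ?_, by abel⟩⟩
  · intro a b h
    by_contra hab
    have hne : a ≠ b := fun e => hab (congrArg deg e)
    refine h ?_
    have h1 : (D * H) a b = 0 := by
      refine Finset.sum_eq_zero fun c _ => ?_
      by_contra h
      have h1 := hD.deg_eq _ _ (left_ne_zero_of_mul h)
      have h2 := hH0 _ _ (right_ne_zero_of_mul h)
      omega
    have h2 : (H * D) a b = 0 := by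
      refine Finset.sum_eq_zero fun c _ => ?_
      by_contra h
      have h1 := hH0 _ _ (left_ne_zero_of_mul h)
      have h2 := hD.deg_eq _ _ (right_ne_zero_of_mul h)
      omega
    simp [Matrix.one_apply_ne hne, h1, h2]
  · rw [sub_mul, add_mul, hDH, mul_assoc, hD.mul_self]
    simp
  · rw [mul_sub, mul_add, ← mul_assoc, ← mul_assoc, hDH, hD.mul_self]
    simp

/-- The cycles of `D` in degree `0` that are not boundaries, as vectors on the whole basis. -/
def nontrivialCycles (D : Matrix α α (ZMod 2)) (deg : α → ℤ) : Set (α → ZMod 2) :=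
  {v | (∀ a, v a ≠ 0 → deg a = 0) ∧ D *ᵥ v = 0 ∧ v ∉ LinearMap.range D.mulVecLin}

theorem Splitting.P_mulVec_ne_zero {D : Matrix α α (ZMod 2)} {deg : α → ℤ} (s : Splitting D deg)
    {v : α → ZMod 2} (hv : v ∈ nontrivialCycles D deg) : s.P *ᵥ v ≠ 0 := by
  intro h
  refine hv.2.2 ⟨s.H *ᵥ v, ?_⟩
  have h1 := congrArg (· *ᵥ v) s.homotopy
  simp only [Matrix.add_mulVec, h, ← Matrix.mulVec_mulVec, hv.2.1, Matrix.mulVec_zero,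
    Matrix.one_mulVec, zero_add, add_zero] at h1
  simpa using h1

theorem Splitting.mulVec_apply_eq_zero {D : Matrix α α (ZMod 2)} {deg : α → ℤ}
    (s : Splitting D deg) {i : ℤ} {f : α → ZMod 2} (hf : ∀ a, f a ≠ 0 → deg a = i) {a : α}
    (ha : deg a ≠ i) : (s.P *ᵥ f) a = 0 := by
  refine Finset.sum_eq_zero fun c _ => ?_
  by_contra h
  exact ha ((s.deg_eq _ _ (left_ne_zero_of_mul h)).trans (hf _ (right_ne_zero_of_mul h)))

/-! ### The product differential -/

/-- The product differential `D ⊗ 1 + 1 ⊗ D'`. -/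
def prodDiff (D : Matrix α α (ZMod 2)) (D' : Matrix β β (ZMod 2)) :
    Matrix (α × β) (α × β) (ZMod 2) :=
  D ⊗ₖ (1 : Matrix β β (ZMod 2)) + (1 : Matrix α α (ZMod 2)) ⊗ₖ D'

/-- The gauge space in terms of the product differential: the boundaries together with the products
of cycles of opposite nonzero degrees. -/
def gauge (D : Matrix α α (ZMod 2)) (deg : α → ℤ) (D' : Matrix β β (ZMod 2)) (deg' : β → ℤ) :
    Submodule (ZMod 2) (α × β → ZMod 2) :=
  LinearMap.range (prodDiff D D').mulVecLin ⊔ Submodule.span (ZMod 2)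
    {w | ∃ i : ℤ, i ≠ 0 ∧ ∃ f : α → ZMod 2, ∃ g : β → ZMod 2,
      (∀ a, f a ≠ 0 → deg a = i) ∧ D *ᵥ f = 0 ∧ (∀ b, g b ≠ 0 → deg' b = -i) ∧ D' *ᵥ g = 0 ∧
      w = fun c => f c.1 * g c.2}

theorem kronecker_mulVec_tensor (M : Matrix α α (ZMod 2)) (N : Matrix β β (ZMod 2))
    (f : α → ZMod 2) (g : β → ZMod 2) (a : α) (b : β) :
    ((M ⊗ₖ N) *ᵥ fun c : α × β => f c.1 * g c.2) (a, b) = (M *ᵥ f) a * (N *ᵥ g) b := by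
  simp only [Matrix.mulVec, dotProduct, Finset.sum_mul_sum, Fintype.sum_prod_type,
    Matrix.kronecker_apply]
  exact Finset.sum_congr rfl fun _ _ => Finset.sum_congr rfl fun _ _ => by ring

theorem kronecker_one_mulVec (M : Matrix α α (ZMod 2)) (y : α × β → ZMod 2) (a : α) (b : β) :
    ((M ⊗ₖ (1 : Matrix β β (ZMod 2))) *ᵥ y) (a, b) = (M *ᵥ fun a => y (a, b)) a := by
  simp [Matrix.mulVec, dotProduct, Fintype.sum_prod_type, Matrix.one_apply]

theorem one_kronecker_mulVec (M : Matrix β β (ZMod 2)) (y : α × β → ZMod 2) (a : α) (b : β) :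
    (((1 : Matrix α α (ZMod 2)) ⊗ₖ M) *ᵥ y) (a, b) = (M *ᵥ fun b => y (a, b)) b := by
  simp [Matrix.mulVec, dotProduct, Fintype.sum_prod_type, Matrix.one_apply]

variable {D : Matrix α α (ZMod 2)} {deg : α → ℤ} {D' : Matrix β β (ZMod 2)} {deg' : β → ℤ}

/-- `P ⊗ P'` is homotopic to the identity, through `H ⊗ 1 + P ⊗ H'`. -/
theorem Splitting.prod_homotopy (s : Splitting D deg) (s' : Splitting D' deg') :
    s.P ⊗ₖ s'.P + (prodDiff D D' * (s.H ⊗ₖ 1 + s.P ⊗ₖ s'.H) +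
      (s.H ⊗ₖ 1 + s.P ⊗ₖ s'.H) * prodDiff D D') = 1 := by
  have h1 : s.P ⊗ₖ s'.P + s.P ⊗ₖ (D' * s'.H + s'.H * D') = s.P ⊗ₖ 1 := by
    rw [← Matrix.kronecker_add, s'.homotopy]
  have h2 : s.P ⊗ₖ (1 : Matrix β β (ZMod 2)) + (D * s.H + s.H * D) ⊗ₖ 1 = 1 := by
    rw [← Matrix.add_kronecker, s.homotopy, Matrix.one_kronecker_one]
  have h3 : s.H ⊗ₖ D' + s.H ⊗ₖ D' = 0 := by
    ext i j
    exact CharTwo.add_self_eq_zero _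
  rw [prodDiff, ← h2, ← h1]
  simp only [mul_add, add_mul, ← Matrix.mul_kronecker_mul, mul_one, one_mul, s.P_mul, s.mul_P,
    Matrix.zero_kronecker, Matrix.kronecker_add, Matrix.add_kronecker, zero_add, add_zero]
  refine Eq.trans ?_ (add_zero _)
  rw [← h3]
  abel

theorem Splitting.kronecker_mul_prodDiff (s : Splitting D deg) (s' : Splitting D' deg') :
    s.P ⊗ₖ s'.P * prodDiff D D' = 0 := by
  simp [prodDiff, mul_add, ← Matrix.mul_kronecker_mul, s.P_mul, s'.P_mul]

theorem middle_eq_zero_of_mem_gauge (s : Splitting D deg) (s' : Splitting D' deg')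
    {x : α × β → ZMod 2} (hx : x ∈ gauge D deg D' deg') {a : α} (b : β) (ha : deg a = 0) :
    ((s.P ⊗ₖ s'.P) *ᵥ x) (a, b) = 0 := by
  suffices h : gauge D deg D' deg' ≤
      LinearMap.ker (LinearMap.proj (a, b) ∘ₗ (s.P ⊗ₖ s'.P).mulVecLin) from h hx
  refine sup_le ?_ (Submodule.span_le.2 ?_)
  · rintro _ ⟨y, rfl⟩
    simp [Matrix.mulVec_mulVec, s.kronecker_mul_prodDiff s']
  · rintro _ ⟨i, hi, f, g, hf, -, -, -, rfl⟩
    have h := kronecker_mulVec_tensor s.P s'.P f g a b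
    rw [s.mulVec_apply_eq_zero hf (by omega), zero_mul] at h
    exact h

theorem mem_gauge_of_middle_eq_zero (s : Splitting D deg) (s' : Splitting D' deg')
    {x : α × β → ZMod 2} (hx : ∀ c, x c ≠ 0 → deg c.1 + deg' c.2 = 0)
    (hx0 : prodDiff D D' *ᵥ x = 0)
    (h : ∀ a b, deg a = 0 → deg' b = 0 → ((s.P ⊗ₖ s'.P) *ᵥ x) (a, b) = 0) :
    x ∈ gauge D deg D' deg' := by
  have h1 := congrArg (· *ᵥ x) (s.prod_homotopy s')
  simp only [Matrix.add_mulVec, ← Matrix.mulVec_mulVec, hx0, Matrix.mulVec_zero,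
    Matrix.one_mulVec, add_zero] at h1
  rw [← h1]
  refine add_mem ?_ (Submodule.mem_sup_left ⟨_, rfl⟩)
  -- `(P ⊗ P') x` is a combination of tensors of columns; those of bidegree `(0, 0)` add up to `0`.
  have key : (s.P ⊗ₖ s'.P) *ᵥ x = ∑ c : α × β,
      if deg c.1 = 0 then 0 else x c • fun d : α × β => s.P d.1 c.1 * s'.P d.2 c.2 := by
    ext ⟨a, b⟩
    rw [Finset.sum_apply]
    by_cases hab : deg a = 0 ∧ deg' b = 0
    · rw [h a b hab.1 hab.2, eq_comm]
      refine Finset.sum_eq_zero fun c _ => ?_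
      split_ifs with hc
      · rfl
      · have : s.P a c.1 = 0 := by
          by_contra h'
          exact hc ((s.deg_eq _ _ h').symm.trans hab.1)
        simp [this]
    · refine Finset.sum_congr rfl fun c _ => ?_
      split_ifs with hc
      · by_contra h'
        have e1 : deg a = deg c.1 := s.deg_eq _ _ (left_ne_zero_of_mul (left_ne_zero_of_mul h'))
        have e2 : deg' b = deg' c.2 := s'.deg_eq _ _ (right_ne_zero_of_mul (left_ne_zero_of_mul h'))
        have e3 : deg c.1 + deg' c.2 = 0 := hx _ (right_ne_zero_of_mul h')
        exact hab ⟨by omega, by omega⟩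
      · simp [mul_comm]
  rw [key]
  refine Submodule.sum_mem _ fun c _ => ?_
  split_ifs with hc
  · exact zero_mem _
  by_cases hxc : x c = 0
  · simp [hxc]
  refine Submodule.smul_mem _ _ (Submodule.mem_sup_right (Submodule.subset_span ?_))
  have hdeg := hx c hxc
  refine ⟨deg c.1, hc, fun a => s.P a c.1, fun b => s'.P b c.2, fun a ha => s.deg_eq _ _ ha, ?_,
    fun b hb => ?_, ?_, rfl⟩
  · exact funext fun a => congrFun (congrFun s.mul_P a) c.1
  · have := s'.deg_eq _ _ hb
    omega
  · exact funext fun b => congrFun (congrFun s'.mul_P b) c.2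

/-! ### Weight bounds -/

/-- The nontrivial dressed logical operators in terms of the product differential, as vectors on all
pairs of basis elements. -/
def dressed (D : Matrix α α (ZMod 2)) (deg : α → ℤ) (D' : Matrix β β (ZMod 2)) (deg' : β → ℤ) :
    Set (α × β → ZMod 2) :=
  {x | (∀ c, x c ≠ 0 → deg c.1 + deg' c.2 = 0) ∧ prodDiff D D' *ᵥ x = 0 ∧
    x ∉ gauge D deg D' deg'}

/-- The support of `x` in the middle sector. -/
def midSupport (deg : α → ℤ) (deg' : β → ℤ) (x : α × β → ZMod 2) : Finset (α × β) :=
  Finset.univ.filter fun c => deg c.1 = 0 ∧ deg' c.2 = 0 ∧ x c ≠ 0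

theorem card_midSupport_le (deg : α → ℤ) (deg' : β → ℤ) (x : α × β → ZMod 2) :
    (midSupport deg deg' x).card ≤ hammingNorm x :=
  Finset.card_le_card fun c hc => by
    simp only [midSupport, Finset.mem_filter] at hc ⊢
    exact ⟨hc.1, hc.2.2.2⟩

theorem exists_middle_ne_zero (s : Splitting D deg) (s' : Splitting D' deg')
    {x : α × β → ZMod 2} (hx : x ∈ dressed D deg D' deg') :
    ∃ a b, deg a = 0 ∧ deg' b = 0 ∧ ((s.P ⊗ₖ s'.P) *ᵥ x) (a, b) ≠ 0 := by
  by_contra! h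
  exact hx.2.2 (mem_gauge_of_middle_eq_zero s s' hx.1 hx.2.1 h)

/-- Contracting a dressed logical operator with a suitable row of `P'` gives a nontrivial cycle of
the first factor. -/
theorem exists_nontrivialCycle_left (s : Splitting D deg) (s' : Splitting D' deg')
    {x : α × β → ZMod 2} (hx : x ∈ dressed D deg D' deg') :
    ∃ v ∈ nontrivialCycles D deg, hammingNorm v ≤ (midSupport deg deg' x).card := by
  obtain ⟨a₀, b₀, -, hb₀, hab⟩ := exists_middle_ne_zero s s' hx
  set y := ((1 : Matrix α α (ZMod 2)) ⊗ₖ s'.P) *ᵥ x with hy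
  set v : α → ZMod 2 := fun a => y (a, b₀) with hv
  have hsupp : ∀ a, v a ≠ 0 → ∃ b, (a, b) ∈ midSupport deg deg' x := by
    intro a ha
    simp only [hv, hy, one_kronecker_mulVec] at ha
    obtain ⟨b, -, hb⟩ := Finset.exists_ne_zero_of_sum_ne_zero ha
    have h1 := s'.deg_eq _ _ (left_ne_zero_of_mul hb)
    have h2 := hx.1 _ (right_ne_zero_of_mul hb)
    simp only at h2
    refine ⟨b, Finset.mem_filter.2 ⟨Finset.mem_univ _, ?_, ?_, right_ne_zero_of_mul hb⟩⟩
    · show deg a = 0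
      omega
    · show deg' b = 0
      omega
  have hDy : (D ⊗ₖ (1 : Matrix β β (ZMod 2))) *ᵥ y = 0 := by
    have h : ((1 : Matrix α α (ZMod 2)) ⊗ₖ s'.P) * prodDiff D D' = D ⊗ₖ s'.P := by
      simp [prodDiff, mul_add, ← Matrix.mul_kronecker_mul, s'.P_mul]
    rw [hy, Matrix.mulVec_mulVec, ← Matrix.mul_kronecker_mul, mul_one, one_mul, ← h,
      ← Matrix.mulVec_mulVec, hx.2.1, Matrix.mulVec_zero]
  have hPv : (s.P *ᵥ v) a₀ ≠ 0 := by
    rw [hv, ← kronecker_one_mulVec, hy, Matrix.mulVec_mulVec, ← Matrix.mul_kronecker_mul, mul_one,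
      one_mul]
    exact hab
  refine ⟨v, ⟨fun a ha => ?_, funext fun a => ?_, ?_⟩, ?_⟩
  · obtain ⟨b, hb⟩ := hsupp a ha
    exact (Finset.mem_filter.1 hb).2.1
  · rw [hv, ← kronecker_one_mulVec, hDy]
    rfl
  · rintro ⟨z, hz⟩
    refine hPv ?_
    rw [← hz, Matrix.mulVecLin_apply, Matrix.mulVec_mulVec, s.P_mul]
    simp
  · refine le_trans (Finset.card_le_card fun a ha => ?_) (Finset.card_image_le (f := Prod.fst))
    obtain ⟨b, hb⟩ := hsupp a (Finset.mem_filter.1 ha).2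
    exact Finset.mem_image.2 ⟨_, hb, rfl⟩

/-- Contracting a dressed logical operator with a suitable row of `P` gives a nontrivial cycle of
the second factor. -/
theorem exists_nontrivialCycle_right (s : Splitting D deg) (s' : Splitting D' deg')
    {x : α × β → ZMod 2} (hx : x ∈ dressed D deg D' deg') :
    ∃ v ∈ nontrivialCycles D' deg', hammingNorm v ≤ (midSupport deg deg' x).card := by
  obtain ⟨a₀, b₀, ha₀, -, hab⟩ := exists_middle_ne_zero s s' hx
  set y := (s.P ⊗ₖ (1 : Matrix β β (ZMod 2))) *ᵥ x with hy
  set v : β → ZMod 2 := fun b => y (a₀, b) with hv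
  have hsupp : ∀ b, v b ≠ 0 → ∃ a, (a, b) ∈ midSupport deg deg' x := by
    intro b hb
    simp only [hv, hy, kronecker_one_mulVec] at hb
    obtain ⟨a, -, ha⟩ := Finset.exists_ne_zero_of_sum_ne_zero hb
    have h1 := s.deg_eq _ _ (left_ne_zero_of_mul ha)
    have h2 := hx.1 _ (right_ne_zero_of_mul ha)
    simp only at h2
    refine ⟨a, Finset.mem_filter.2 ⟨Finset.mem_univ _, ?_, ?_, right_ne_zero_of_mul ha⟩⟩
    · show deg a = 0
      omega
    · show deg' b = 0
      omega
  have hDy : ((1 : Matrix α α (ZMod 2)) ⊗ₖ D') *ᵥ y = 0 := by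
    have h : (s.P ⊗ₖ (1 : Matrix β β (ZMod 2))) * prodDiff D D' = s.P ⊗ₖ D' := by
      simp [prodDiff, mul_add, ← Matrix.mul_kronecker_mul, s.P_mul]
    rw [hy, Matrix.mulVec_mulVec, ← Matrix.mul_kronecker_mul, mul_one, one_mul, ← h,
      ← Matrix.mulVec_mulVec, hx.2.1, Matrix.mulVec_zero]
  have hPv : (s'.P *ᵥ v) b₀ ≠ 0 := by
    rw [hv, ← one_kronecker_mulVec, hy, Matrix.mulVec_mulVec, ← Matrix.mul_kronecker_mul, mul_one,
      one_mul]
    exact hab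
  refine ⟨v, ⟨fun b hb => ?_, funext fun b => ?_, ?_⟩, ?_⟩
  · obtain ⟨a, ha⟩ := hsupp b hb
    exact (Finset.mem_filter.1 ha).2.2.1
  · rw [hv, ← one_kronecker_mulVec, hDy]
    rfl
  · rintro ⟨z, hz⟩
    refine hPv ?_
    rw [← hz, Matrix.mulVecLin_apply, Matrix.mulVec_mulVec, s'.P_mul]
    simp
  · refine le_trans (Finset.card_le_card fun b hb => ?_) (Finset.card_image_le (f := Prod.snd))
    obtain ⟨a, ha⟩ := hsupp b (Finset.mem_filter.1 hb).2
    exact Finset.mem_image.2 ⟨_, ha, rfl⟩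

theorem tensor_mem_dressed (s : Splitting D deg) (s' : Splitting D' deg') {u : α → ZMod 2}
    {u' : β → ZMod 2} (hu : u ∈ nontrivialCycles D deg) (hu' : u' ∈ nontrivialCycles D' deg') :
    (fun c => u c.1 * u' c.2) ∈ dressed D deg D' deg' := by
  refine ⟨fun c hc => ?_, ?_, fun hg => ?_⟩
  · rw [hu.1 _ (left_ne_zero_of_mul hc), hu'.1 _ (right_ne_zero_of_mul hc), add_zero]
  · ext ⟨a, b⟩
    rw [prodDiff, Matrix.add_mulVec, Pi.add_apply, kronecker_mulVec_tensor,
      kronecker_mulVec_tensor, hu.2.1, hu'.2.1]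
    simp
  · obtain ⟨a, ha⟩ := Function.ne_iff.1 (s.P_mulVec_ne_zero hu)
    obtain ⟨b, hb⟩ := Function.ne_iff.1 (s'.P_mulVec_ne_zero hu')
    have ha0 : deg a = 0 := by
      by_contra h
      exact ha (s.mulVec_apply_eq_zero hu.1 h)
    have h := middle_eq_zero_of_mem_gauge s s' hg b ha0
    rw [kronecker_mulVec_tensor] at h
    exact mul_ne_zero ha hb h

theorem hammingNorm_tensor (u : α → ZMod 2) (u' : β → ZMod 2) :
    hammingNorm (fun c : α × β => u c.1 * u' c.2) = hammingNorm u * hammingNorm u' := by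
  simp only [hammingNorm, ← Finset.card_product]
  congr 1
  ext c
  simp

theorem minWeight_le {S : Set (α → ZMod 2)} {x : α → ZMod 2} (hx : x ∈ S) :
    minWeight S ≤ hammingNorm x :=
  iInf₂_le x hx

theorem minWeight_le_minWeight {S : Set (α → ZMod 2)} {T : Set (β → ZMod 2)}
    (h : ∀ y ∈ T, ∃ x ∈ S, hammingNorm x ≤ hammingNorm y) : minWeight S ≤ minWeight T := by
  refine le_iInf₂ fun y hy => ?_
  obtain ⟨x, hx, hxy⟩ := h y hy
  exact (minWeight_le hx).trans (Nat.cast_le.2 hxy)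

theorem exists_minWeight_eq {S : Set (α → ZMod 2)} (hS : S.Nonempty) :
    ∃ x ∈ S, minWeight S = hammingNorm x := by
  have : Nonempty S := hS.to_subtype
  obtain ⟨x, hx⟩ := ciInf_mem fun x : S => (hammingNorm x.1 : ℕ∞)
  exact ⟨x.1, x.2, by rw [minWeight, iInf_subtype', ← hx]⟩

theorem minWeight_nontrivialCycles_ne_zero : minWeight (nontrivialCycles D deg) ≠ 0 := by
  refine Order.one_le_iff_ne_zero.1 (le_iInf₂ fun x hx => ?_)
  have : x ≠ 0 := by
    rintro rfl
    exact hx.2.2 (zero_mem _)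
  exact_mod_cast Nat.one_le_iff_ne_zero.2 (hammingNorm_ne_zero_iff.2 this)

theorem max_le_card_midSupport (s : Splitting D deg) (s' : Splitting D' deg')
    {x : α × β → ZMod 2} (hx : x ∈ dressed D deg D' deg') :
    max (minWeight (nontrivialCycles D deg)) (minWeight (nontrivialCycles D' deg')) ≤
      ((midSupport deg deg' x).card : ℕ∞) := by
  obtain ⟨v, hv, hvx⟩ := exists_nontrivialCycle_left s s' hx
  obtain ⟨w, hw, hwx⟩ := exists_nontrivialCycle_right s s' hx
  exact max_le ((minWeight_le hv).trans (Nat.cast_le.2 hvx))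
    ((minWeight_le hw).trans (Nat.cast_le.2 hwx))

theorem max_le_minWeight_dressed (s : Splitting D deg) (s' : Splitting D' deg') :
    max (minWeight (nontrivialCycles D deg)) (minWeight (nontrivialCycles D' deg')) ≤
      minWeight (dressed D deg D' deg') :=
  le_iInf₂ fun x hx => (max_le_card_midSupport s s' hx).trans
    (Nat.cast_le.2 (card_midSupport_le deg deg' x))

theorem minWeight_dressed_le_mul (s : Splitting D deg) (s' : Splitting D' deg') :
    minWeight (dressed D deg D' deg') ≤
      minWeight (nontrivialCycles D deg) * minWeight (nontrivialCycles D' deg') := by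
  -- If one factor has no nontrivial cycle, the right-hand side is `⊤` since the other is not `0`.
  rcases (nontrivialCycles D deg).eq_empty_or_nonempty with h | h
  · have : minWeight (nontrivialCycles D deg) = ⊤ := by simp [minWeight, h]
    rw [this, ENat.top_mul minWeight_nontrivialCycles_ne_zero]
    exact le_top
  rcases (nontrivialCycles D' deg').eq_empty_or_nonempty with h' | h'
  · have : minWeight (nontrivialCycles D' deg') = ⊤ := by simp [minWeight, h']
    rw [this, ENat.mul_top minWeight_nontrivialCycles_ne_zero]
    exact le_top
  obtain ⟨u, hu, e⟩ := exists_minWeight_eq h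
  obtain ⟨u', hu', e'⟩ := exists_minWeight_eq h'
  rw [e, e', ← Nat.cast_mul, ← hammingNorm_tensor]
  exact minWeight_le (tensor_mem_dressed s s' hu hu')

/-! ### Homogeneous vectors -/

/-- Extension by zero of a vector on the basis elements of degree `i`. -/
def extend (deg : α → ℤ) (i : ℤ) : ({a // deg a = i} → ZMod 2) →ₗ[ZMod 2] (α → ZMod 2) where
  toFun v a := if h : deg a = i then v ⟨a, h⟩ else 0
  map_add' v w := by
    ext a
    by_cases h : deg a = i <;> simp [h]
  map_smul' r v := by
    ext a
    by_cases h : deg a = i <;> simp [h]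

/-- Restriction of a vector to the basis elements of degree `i`. -/
def restrict (deg : α → ℤ) (i : ℤ) : (α → ZMod 2) →ₗ[ZMod 2] ({a // deg a = i} → ZMod 2) :=
  LinearMap.funLeft (ZMod 2) (ZMod 2) Subtype.val

theorem extend_val {i : ℤ} (v : {a // deg a = i} → ZMod 2) (a : {a // deg a = i}) :
    extend deg i v a.1 = v a := by
  simp [extend, a.2]

theorem deg_eq_of_extend_ne_zero {i : ℤ} {v : {a // deg a = i} → ZMod 2} {a : α}
    (h : extend deg i v a ≠ 0) : deg a = i := by
  by_contra h'
  exact h (dif_neg h')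

theorem restrict_extend {i : ℤ} (v : {a // deg a = i} → ZMod 2) :
    restrict deg i (extend deg i v) = v :=
  funext fun a => extend_val v a

theorem extend_restrict {i : ℤ} {v : α → ZMod 2} (hv : ∀ a, v a ≠ 0 → deg a = i) :
    extend deg i (restrict deg i v) = v := by
  ext a
  by_cases h : deg a = i
  · exact dif_pos h
  · by_cases h0 : v a = 0
    · rw [h0]
      exact dif_neg h
    · exact absurd (hv a h0) h

theorem hammingNorm_extend {i : ℤ} (v : {a // deg a = i} → ZMod 2) :
    hammingNorm (extend deg i v) = hammingNorm v := by
  rw [hammingNorm, hammingNorm, ← Finset.card_map (Function.Embedding.subtype _)]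
  congr 1
  ext a
  simp only [Finset.mem_filter, Finset.mem_univ, true_and, Finset.mem_map,
    Function.Embedding.subtype_apply]
  constructor
  · intro h
    have ha := deg_eq_of_extend_ne_zero h
    exact ⟨⟨a, ha⟩, by rwa [← extend_val v ⟨a, ha⟩], rfl⟩
  · rintro ⟨b, hb, rfl⟩
    rwa [extend_val]

theorem submatrix_mulVec_restrict (M : Matrix α α (ZMod 2)) (i j : ℤ) (v : α → ZMod 2)
    (h : ∀ a c, deg a = i → M a c * v c ≠ 0 → deg c = j) :
    (M.submatrix (Subtype.val : {a // deg a = i} → α) (Subtype.val : {a // deg a = j} → α)) *ᵥ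
      restrict deg j v = restrict deg i (M *ᵥ v) := by
  ext a
  refine Finset.sum_of_injOn Subtype.val Subtype.val_injective.injOn
    (fun _ _ => Finset.mem_coe.2 (Finset.mem_univ _)) ?_ (fun _ _ => rfl)
  intro c _ hc
  by_contra h0
  exact hc ⟨⟨c, h a.1 c a.2 h0⟩, by simp, rfl⟩

theorem mem_ker_submatrix_iff {ε i j : ℤ} (hD : IsDifferential D deg ε) (hij : i = j + ε)
    (v : {a // deg a = j} → ZMod 2) :
    v ∈ LinearMap.ker (D.submatrix (Subtype.val : {a // deg a = i} → α)
      (Subtype.val : {a // deg a = j} → α)).mulVecLin ↔ D *ᵥ extend deg j v = 0 := by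
  have h1 := submatrix_mulVec_restrict D i j (extend deg j v)
    fun a c _ h => deg_eq_of_extend_ne_zero (right_ne_zero_of_mul h)
  rw [restrict_extend] at h1
  rw [LinearMap.mem_ker, Matrix.mulVecLin_apply, h1]
  constructor
  · intro h
    rw [← extend_restrict (deg := deg) (i := i) (v := D *ᵥ extend deg j v), h, map_zero]
    intro a ha
    obtain ⟨c, -, hc⟩ := Finset.exists_ne_zero_of_sum_ne_zero ha
    rw [hD.deg_eq _ _ (left_ne_zero_of_mul hc),
      deg_eq_of_extend_ne_zero (right_ne_zero_of_mul hc), hij]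
  · intro h
    rw [h, map_zero]

theorem restrict_mulVec_mem_range_submatrix {ε i j : ℤ} (hD : IsDifferential D deg ε)
    (hij : i = j + ε) (y : α → ZMod 2) :
    restrict deg i (D *ᵥ y) ∈ LinearMap.range (D.submatrix (Subtype.val : {a // deg a = i} → α)
      (Subtype.val : {a // deg a = j} → α)).mulVecLin := by
  refine ⟨restrict deg j y, submatrix_mulVec_restrict D i j y fun a c ha h => ?_⟩
  have := hD.deg_eq _ _ (left_ne_zero_of_mul h)
  omega

theorem mem_range_submatrix_iff {ε i j : ℤ} (hD : IsDifferential D deg ε) (hij : i = j + ε)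
    (v : {a // deg a = i} → ZMod 2) :
    v ∈ LinearMap.range (D.submatrix (Subtype.val : {a // deg a = i} → α)
      (Subtype.val : {a // deg a = j} → α)).mulVecLin ↔
      extend deg i v ∈ LinearMap.range D.mulVecLin := by
  constructor
  · rintro ⟨y, rfl⟩
    refine ⟨extend deg j y, ?_⟩
    have h1 := submatrix_mulVec_restrict D i j (extend deg j y)
      fun a c _ h => deg_eq_of_extend_ne_zero (right_ne_zero_of_mul h)
    rw [restrict_extend] at h1
    rw [Matrix.mulVecLin_apply, Matrix.mulVecLin_apply, h1, extend_restrict]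
    intro a ha
    obtain ⟨c, -, hc⟩ := Finset.exists_ne_zero_of_sum_ne_zero ha
    rw [hD.deg_eq _ _ (left_ne_zero_of_mul hc),
      deg_eq_of_extend_ne_zero (right_ne_zero_of_mul hc), hij]
  · rintro ⟨y, hy⟩
    rw [← restrict_extend v, ← hy]
    exact restrict_mulVec_mem_range_submatrix hD hij y

end Differential

/-! ### The codes in terms of differentials -/

section Translation

theorem isDifferential_bd (C : BasedComplex.{u}) : IsDifferential C.bd C.deg (-1) :=
  ⟨C.bd_bd, fun a b h => by have := C.bd_deg a b h; omega⟩

theorem isDifferential_bd_transpose (C : BasedComplex.{u}) : IsDifferential C.bdᵀ C.deg 1 :=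
  ⟨by rw [← Matrix.transpose_mul, C.bd_bd, Matrix.transpose_zero],
    fun a b h => (C.bd_deg b a h).symm⟩

theorem minWeight_eq_minWeight_extend {α : Type u} [Fintype α] [DecidableEq α] {deg : α → ℤ} {i : ℤ}
    {S : Set ({a // deg a = i} → ZMod 2)} {T : Set (α → ZMod 2)}
    (hT : ∀ v ∈ T, ∀ a, v a ≠ 0 → deg a = i) (h : ∀ v, v ∈ S ↔ extend deg i v ∈ T) :
    minWeight S = minWeight T := by
  refine le_antisymm (minWeight_le_minWeight fun y hy => ⟨restrict deg i y, ?_, ?_⟩)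
    (minWeight_le_minWeight fun x hx => ⟨extend deg i x, (h x).1 hx, (hammingNorm_extend x).le⟩)
  · rw [h, extend_restrict (hT y hy)]
    exact hy
  · rw [← hammingNorm_extend, extend_restrict (hT y hy)]

theorem dX_eq (C : BasedComplex.{u}) : C.dX = minWeight (nontrivialCycles C.bdᵀ C.deg) := by
  refine minWeight_eq_minWeight_extend (fun v hv => hv.1) fun v => ?_
  have h1 : v ∈ C.kerHZ ↔ _ := mem_ker_submatrix_iff C.isDifferential_bd_transpose
    (i := 1) (j := 0) rfl v
  have h2 : v ∈ C.rsHX ↔ _ := mem_range_submatrix_iff C.isDifferential_bd_transpose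
    (i := 0) (j := -1) rfl v
  exact ⟨fun h => ⟨fun _ => deg_eq_of_extend_ne_zero, h1.1 h.1, fun h' => h.2 (h2.2 h')⟩,
    fun h => ⟨h1.2 h.2.1, fun h' => h.2.2 (h2.1 h')⟩⟩

theorem dZ_eq (C : BasedComplex.{u}) : C.dZ = minWeight (nontrivialCycles C.bd C.deg) := by
  refine minWeight_eq_minWeight_extend (fun v hv => hv.1) fun v => ?_
  have h1 : v ∈ C.kerHX ↔ _ := mem_ker_submatrix_iff C.isDifferential_bd
    (i := -1) (j := 0) rfl v
  have h2 : v ∈ C.rsHZ ↔ _ := mem_range_submatrix_iff C.isDifferential_bd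
    (i := 0) (j := 1) rfl v
  exact ⟨fun h => ⟨fun _ => deg_eq_of_extend_ne_zero, h1.1 h.1, fun h' => h.2 (h2.2 h')⟩,
    fun h => ⟨h1.2 h.2.1, fun h' => h.2.2 (h2.1 h')⟩⟩

theorem mem_cocycles_iff (C : BasedComplex.{u}) (i : ℤ) (v : C.cells i → ZMod 2) :
    v ∈ C.cocycles i ↔ C.bdᵀ *ᵥ extend C.deg i v = 0 :=
  mem_ker_submatrix_iff C.isDifferential_bd_transpose rfl v

theorem mem_cycles_iff (C : BasedComplex.{u}) (i : ℤ) (v : C.cells i → ZMod 2) :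
    v ∈ C.cycles i ↔ C.bd *ᵥ extend C.deg i v = 0 :=
  mem_ker_submatrix_iff C.isDifferential_bd rfl v

variable (A : BasedComplex.{u}) (B : BasedComplex.{v})

theorem prod_bd_transpose : (A.prod B).bdᵀ = prodDiff A.bdᵀ B.bdᵀ := by
  simp only [prod, prodDiff, Matrix.transpose_add, ← Matrix.kroneckerMap_transpose,
    Matrix.transpose_one]

theorem extend_tensor {i j : ℤ} (hij : i + j = 0) (f : A.cells i → ZMod 2)
    (g : B.cells j → ZMod 2) :
    extend (A.prod B).deg 0 (tensor A B f g) =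
      fun c : A.Cell × B.Cell => extend A.deg i f c.1 * extend B.deg j g c.2 := by
  ext c
  by_cases h1 : A.deg c.1 = i
  · by_cases h2 : B.deg c.2 = j
    · have h : (A.prod B).deg c = 0 := by
        show A.deg c.1 + B.deg c.2 = 0
        omega
      simp [extend, tensor, h, h1, h2]
    · simp [extend, tensor, h2]
  · simp [extend, tensor, h1]

/-- The gauge spaces of both types are the degree-`0` part of the gauge space of the product
differential. -/
theorem mem_sup_span_tensor_iff {D : Matrix A.Cell A.Cell (ZMod 2)}
    {D' : Matrix B.Cell B.Cell (ZMod 2)} {ε k : ℤ}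
    (hD : IsDifferential (prodDiff D D') (A.prod B).deg ε) (hk : 0 = k + ε)
    (Z : ∀ i, Submodule (ZMod 2) (A.cells i → ZMod 2))
    (Z' : ∀ i, Submodule (ZMod 2) (B.cells i → ZMod 2))
    (hZ : ∀ i v, v ∈ Z i ↔ D *ᵥ extend A.deg i v = 0)
    (hZ' : ∀ i v, v ∈ Z' i ↔ D' *ᵥ extend B.deg i v = 0)
    (x : (A.prod B).cells 0 → ZMod 2) :
    x ∈ LinearMap.range ((prodDiff D D').submatrix (Subtype.val : (A.prod B).cells 0 → _)
        (Subtype.val : (A.prod B).cells k → _)).mulVecLin ⊔ Submodule.span (ZMod 2)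
        {w | ∃ i : ℤ, i ≠ 0 ∧ ∃ f ∈ Z i, ∃ g ∈ Z' (-i), w = tensor A B f g} ↔
      extend (A.prod B).deg 0 x ∈ gauge D A.deg D' B.deg := by
  constructor
  · suffices h : _ ≤ (gauge D A.deg D' B.deg).comap (extend (A.prod B).deg 0) from fun hx => h hx
    refine sup_le (fun y hy => ?_) (Submodule.span_le.2 ?_)
    · exact Submodule.mem_sup_left ((mem_range_submatrix_iff hD hk y).1 hy)
    · rintro _ ⟨i, hi, f, hf, g, hg, rfl⟩
      refine Submodule.mem_sup_right (Submodule.subset_span ⟨i, hi, extend A.deg i f,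
        extend B.deg (-i) g, fun _ => deg_eq_of_extend_ne_zero, (hZ _ _).1 hf,
        fun _ => deg_eq_of_extend_ne_zero, (hZ' _ _).1 hg, ?_⟩)
      exact extend_tensor A B (by omega) f g
  · intro hx
    rw [← restrict_extend x]
    generalize extend (A.prod B).deg 0 x = y at hx
    rw [← Submodule.mem_comap]
    revert y
    change gauge D A.deg D' B.deg ≤ _
    refine sup_le ?_ (Submodule.span_le.2 ?_)
    · rintro _ ⟨y, rfl⟩
      exact Submodule.mem_sup_left (restrict_mulVec_mem_range_submatrix hD hk y)
    · rintro _ ⟨i, hi, f, g, hf, hf0, hg, hg0, rfl⟩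
      refine Submodule.mem_sup_right (Submodule.subset_span ⟨i, hi, restrict A.deg i f, ?_,
        restrict B.deg (-i) g, ?_, ?_⟩)
      · rwa [hZ, extend_restrict hf]
      · rwa [hZ', extend_restrict hg]
      · have h := extend_tensor A B (by omega) (restrict A.deg i f) (restrict B.deg (-i) g)
        rw [extend_restrict hf, extend_restrict hg] at h
        rw [← h, restrict_extend]

theorem mem_dressedX_iff (x : (A.prod B).cells 0 → ZMod 2) :
    x ∈ dressedX A B ↔ extend (A.prod B).deg 0 x ∈ dressed A.bdᵀ A.deg B.bdᵀ B.deg := by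
  have hD := (A.prod B).isDifferential_bd_transpose
  have h1 : x ∈ (A.prod B).kerHZ ↔ _ := mem_ker_submatrix_iff hD (i := 1) (j := 0) rfl x
  rw [prod_bd_transpose] at hD h1
  have h2 := mem_sup_span_tensor_iff A B hD (k := -1) rfl A.cocycles B.cocycles
    A.mem_cocycles_iff B.mem_cocycles_iff x
  rw [← prod_bd_transpose] at h2
  change x ∈ xGauge A B ↔ _ at h2
  exact ⟨fun h => ⟨fun _ => deg_eq_of_extend_ne_zero, h1.1 h.1, fun h' => h.2 (h2.2 h')⟩,
    fun h => ⟨h1.2 h.2.1, fun h' => h.2.2 (h2.1 h')⟩⟩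

theorem mem_dressedZ_iff (x : (A.prod B).cells 0 → ZMod 2) :
    x ∈ dressedZ A B ↔ extend (A.prod B).deg 0 x ∈ dressed A.bd A.deg B.bd B.deg := by
  have hD := (A.prod B).isDifferential_bd
  have h1 : x ∈ (A.prod B).kerHX ↔ _ := mem_ker_submatrix_iff hD (i := -1) (j := 0) rfl x
  have h2 : x ∈ zGauge A B ↔ _ := mem_sup_span_tensor_iff A B hD (k := 1) rfl A.cycles B.cycles
    A.mem_cycles_iff B.mem_cycles_iff x
  exact ⟨fun h => ⟨fun _ => deg_eq_of_extend_ne_zero, h1.1 h.1, fun h' => h.2 (h2.2 h')⟩,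
    fun h => ⟨h1.2 h.2.1, fun h' => h.2.2 (h2.1 h')⟩⟩

theorem midCosystolicDist_eq :
    midCosystolicDist A B = minWeight (dressed A.bdᵀ A.deg B.bdᵀ B.deg) :=
  minWeight_eq_minWeight_extend (deg := (A.prod B).deg) (fun _ hv => hv.1) (mem_dressedX_iff A B)

theorem midSystolicDist_eq :
    midSystolicDist A B = minWeight (dressed A.bd A.deg B.bd B.deg) :=
  minWeight_eq_minWeight_extend (deg := (A.prod B).deg) (fun _ hv => hv.1) (mem_dressedZ_iff A B)

theorem midWeight_eq (x : (A.prod B).cells 0 → ZMod 2) :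
    midWeight A B x = (midSupport A.deg B.deg (extend (A.prod B).deg 0 x)).card := by
  rw [midWeight, ← Finset.card_map (Function.Embedding.subtype _)]
  refine congrArg Finset.card (Finset.ext fun c => ⟨fun h => ?_, fun h => ?_⟩)
  · obtain ⟨d, hd, rfl⟩ := Finset.mem_map.1 h
    obtain ⟨-, h1, h2, h3⟩ := Finset.mem_filter.1 hd
    exact Finset.mem_filter.2 ⟨Finset.mem_univ _, h1, h2, (extend_val x d).trans_ne h3⟩
  · obtain ⟨-, h1, h2, h3⟩ := Finset.mem_filter.1 h
    have hc := deg_eq_of_extend_ne_zero h3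
    exact Finset.mem_map.2 ⟨⟨c, hc⟩, Finset.mem_filter.2 ⟨Finset.mem_univ _, h1, h2,
      (extend_val x ⟨c, hc⟩).symm.trans_ne h3⟩, rfl⟩

end Translation

end BasedComplex

theorem mainTheorem10 (Q : BasedComplex.{u}) (Q' : BasedComplex.{v}) :
    (max Q.dX Q'.dX ≤ BasedComplex.midCosystolicDist Q Q' ∧
      BasedComplex.midCosystolicDist Q Q' ≤ Q.dX * Q'.dX) ∧
    (max Q.dZ Q'.dZ ≤ BasedComplex.midSystolicDist Q Q' ∧
      BasedComplex.midSystolicDist Q Q' ≤ Q.dZ * Q'.dZ) ∧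
    (∀ x ∈ BasedComplex.dressedX Q Q',
      max Q.dX Q'.dX ≤ (BasedComplex.midWeight Q Q' x : ℕ∞)) ∧
    (∀ z ∈ BasedComplex.dressedZ Q Q',
      max Q.dZ Q'.dZ ≤ (BasedComplex.midWeight Q Q' z : ℕ∞)) := by
  obtain ⟨sX⟩ := BasedComplex.exists_splitting Q.isDifferential_bd_transpose
  obtain ⟨sX'⟩ := BasedComplex.exists_splitting Q'.isDifferential_bd_transpose
  obtain ⟨sZ⟩ := BasedComplex.exists_splitting Q.isDifferential_bd
  obtain ⟨sZ'⟩ := BasedComplex.exists_splitting Q'.isDifferential_bd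
  rw [Q.dX_eq, Q'.dX_eq, Q.dZ_eq, Q'.dZ_eq, BasedComplex.midCosystolicDist_eq,
    BasedComplex.midSystolicDist_eq]
  refine ⟨⟨BasedComplex.max_le_minWeight_dressed sX sX',
    BasedComplex.minWeight_dressed_le_mul sX sX'⟩,
    ⟨BasedComplex.max_le_minWeight_dressed sZ sZ',
    BasedComplex.minWeight_dressed_le_mul sZ sZ'⟩, fun x hx => ?_, fun z hz => ?_⟩
  · rw [BasedComplex.midWeight_eq]
    exact BasedComplex.max_le_card_midSupport sX sX' ((BasedComplex.mem_dressedX_iff Q Q' x).1 hx)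
  · rw [BasedComplex.midWeight_eq]
    exact BasedComplex.max_le_card_midSupport sZ sZ' ((BasedComplex.mem_dressedZ_iff Q Q' z).1 hz)
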